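/- For a group $G$, let $\gamma_n(G)$ ($n\ge 1$, $\gamma_1(G)=G$) be the terms of its lower central series, let $\mathfrak g$ be the augmentation ideal of the integral group ring $\mathbb Z[G]$, and let $D_4(G)=\{g\in G : g-1\in\mathfrak g^4\}$ be the fourth dimension subgroup. A free presentation of $G$ is a surjective homomorphism $F\twoheadrightarrow G$ from a free group $F$, with kernel denoted $R$, written $R\hookrightarrow F\twoheadrightarrow G$; a morphism of free presentations of $G$ is a homomorphism of the free groups compatible with the maps to $G$. The assignments $$(R\hookrightarrow F\twoheadrightarrow G)\mapsto \frac{R\cap\gamma_2(F)}{\gamma_2(R)(R\cap\gamma_4(F))},\qquad (R\hookrightarrow F\twoheadrightarrow G)\mapsto \frac{\gamma_2(F)}{\gamma_2(R)\gamma_4(F)}$$ are functors from the category of free presentations of $G$ to the category of abelian groups; let $\varprojlim$ denote their limits over this category (these limits exist and are functors of $G$). Theorem. For every group $G$ there is a short exact sequence of abelian groups, natural in $G$, $$0\to\varprojlim \frac{R\cap \gamma_2(F)}{\gamma_2(R)(R\cap \gamma_4(F))}\longrightarrow \varprojlim \frac{\gamma_2(F)}{\gamma_2(R)\gamma_4(F)}\longrightarrow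 \frac{D_4(G)}{\gamma_4(G)}\to 0,$$ in which the first map is induced by the inclusions $R\cap\gamma_2(F)\subseteq\gamma_2(F)$, and the second map, followed by the inclusion $D_4(G)/\gamma_4(G)\subseteq\gamma_2(G)/\gamma_4(G)$, is for every free presentation $R\hookrightarrow F\twoheadrightarrow G$ the composite $$\varprojlim\frac{\gamma_2(F)}{\gamma_2(R)\gamma_4(F)}\to\frac{\gamma_2(F)}{\gamma_2(R)\gamma_4(F)}\to\frac{\gamma_2(G)}{\gamma_4(G)}$$ of the limit projection and the map induced by $F\twoheadrightarrow G$. -/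

import Mathlib

open CategoryTheory CategoryTheory.Limits
open scoped commutatorElement

universe u

namespace DimQuot

/-! ### Abelian subquotients of groups -/

section Subquotient

variable {F F' : Type u} [Group F] [Group F']

theorem normal_of_commutator_le {H N : Subgroup F} (h : ⁅H, H⁆ ≤ N) :
    (N.subgroupOf H).Normal where
  conj_mem n hn g := by
    rw [Subgroup.mem_subgroupOf] at hn ⊢
    have h1 : ⁅(g : F), (n : F)⁆ ∈ N := h (Subgroup.commutator_mem_commutator g.2 n.2)
    have h2 : ((g * n * g⁻¹ : H) : F) = ⁅(g : F), (n : F)⁆ * n := by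
      simp [commutatorElement_def]
    rw [h2]
    exact N.mul_mem h1 hn

/-- The quotient group `H / (N ∩ H)`, which is abelian if `[H, H] ≤ N`. -/
abbrev quotCommGroup (H N : Subgroup F) (h : ⁅H, H⁆ ≤ N) : CommGroup (H ⧸ N.subgroupOf H) :=
  haveI := normal_of_commutator_le h
  { (inferInstance : Group (H ⧸ N.subgroupOf H)) with
    mul_comm := by
      intro a b
      induction a using QuotientGroup.induction_on with | _ x
      induction b using QuotientGroup.induction_on with | _ y
      rw [← QuotientGroup.mk_mul, ← QuotientGroup.mk_mul, QuotientGroup.eq,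
        Subgroup.mem_subgroupOf]
      have h1 : ⁅((y : F))⁻¹, ((x : F))⁻¹⁆ ∈ N :=
        h (Subgroup.commutator_mem_commutator (H.inv_mem y.2) (H.inv_mem x.2))
      simpa [commutatorElement_def, mul_assoc] using h1 }

/-- The abelian group `H / (N ∩ H)` for subgroups `N`, `H` of a group with `[H, H] ≤ N`
(in all uses below `N ≤ H`, so that this is `H / N`), written additively. -/
def subquot (H N : Subgroup F) (h : ⁅H, H⁆ ≤ N) : AddCommGrpCat.{u} :=
  letI := quotCommGroup H N h
  AddCommGrpCat.of (Additive (H ⧸ N.subgroupOf H))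

/-- The class of an element of `H` in `H / N`. -/
def subquotMk (H N : Subgroup F) (h : ⁅H, H⁆ ≤ N) (x : H) : subquot H N h :=
  Additive.ofMul (QuotientGroup.mk x : H ⧸ N.subgroupOf H)

theorem subquotMk_surjective (H N : Subgroup F) (h : ⁅H, H⁆ ≤ N) :
    Function.Surjective (subquotMk H N h) := fun y => by
  obtain ⟨x, hx⟩ := QuotientGroup.mk_surjective (s := N.subgroupOf H) (Additive.toMul y)
  exact ⟨x, congrArg Additive.ofMul hx⟩

/-- The homomorphism `H / N ⟶ H' / N'`, `x N ↦ f(x) N'`, induced by a group homomorphism `f`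
with `f(H) ≤ H'` and `f(N) ≤ N'`. -/
def subquotMap {H N : Subgroup F} (h : ⁅H, H⁆ ≤ N) {H' N' : Subgroup F'} (h' : ⁅H', H'⁆ ≤ N')
    (f : F →* F') (hH : H ≤ H'.comap f) (hN : N ≤ N'.comap f) :
    subquot H N h ⟶ subquot H' N' h' :=
  letI := quotCommGroup H N h
  letI := quotCommGroup H' N' h'
  haveI := normal_of_commutator_le h
  haveI := normal_of_commutator_le h'
  AddCommGrpCat.ofHom (MonoidHom.toAdditive
    (QuotientGroup.map (N.subgroupOf H) (N'.subgroupOf H')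
      ((f.comp H.subtype).codRestrict H' fun x => hH x.2) fun _ hx => hN hx))

theorem subquotMap_mk {H N : Subgroup F} (h : ⁅H, H⁆ ≤ N) {H' N' : Subgroup F'}
    (h' : ⁅H', H'⁆ ≤ N') (f : F →* F') (hH : H ≤ H'.comap f) (hN : N ≤ N'.comap f) (x : H) :
    subquotMap h h' f hH hN (subquotMk H N h x) = subquotMk H' N' h' ⟨f x, hH x.2⟩ := rfl

theorem subquot_hom_ext {H N : Subgroup F} {h : ⁅H, H⁆ ≤ N} {A : AddCommGrpCat.{u}}
    {f g : subquot H N h ⟶ A} (hfg : ∀ x, f (subquotMk H N h x) = g (subquotMk H N h x)) :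
    f = g := by
  ext y
  obtain ⟨x, rfl⟩ := subquotMk_surjective H N h y
  exact hfg x

end Subquotient

/-! ### Lower central series, dimension subgroups, dimension quotients -/

section Series

/-- The `n`-th term `γ_n(G)`, `n ≥ 1`, of the lower central series, with `γ_1(G) = G`. -/
abbrev gamma (n : ℕ) (G : Type u) [Group G] : Subgroup G :=
  (⊤ : Subgroup G).lowerCentralSeries (n - 1)

theorem gamma_le_comap (n : ℕ) {G H : Type u} [Group G] [Group H] (f : G →* H) :
    gamma n G ≤ (gamma n H).comap f := by
  have key : ∀ k : ℕ, ((⊤ : Subgroup G).map f).lowerCentralSeries k ≤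
      (⊤ : Subgroup H).lowerCentralSeries k := by
    intro k
    induction k with
    | zero => exact le_top
    | succ k ih => exact Subgroup.commutator_mono ih le_top
  rw [← Subgroup.map_le_iff_le_comap, Subgroup.map_lowerCentralSeries]
  exact key _

theorem commutator_gamma_two_le (G : Type u) [Group G] : ⁅gamma 2 G, gamma 2 G⁆ ≤ gamma 4 G := by
  have h1 : ⁅⁅(⊤ : Subgroup G), gamma 2 G⁆, (⊤ : Subgroup G)⁆ ≤ gamma 4 G := by
    rw [Subgroup.commutator_comm ⊤]
    exact le_rfl
  have h2 : ⁅⁅gamma 2 G, (⊤ : Subgroup G)⁆, (⊤ : Subgroup G)⁆ ≤ gamma 4 G := le_rfl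
  have bot_iff : ∀ A B C : Subgroup G, ⁅⁅A, B⁆, C⁆ ≤ gamma 4 G ↔
      ⁅⁅A.map (QuotientGroup.mk' (gamma 4 G)), B.map (QuotientGroup.mk' (gamma 4 G))⁆,
        C.map (QuotientGroup.mk' (gamma 4 G))⁆ = ⊥ := fun A B C => by
    rw [← Subgroup.map_commutator, ← Subgroup.map_commutator, Subgroup.map_eq_bot_iff,
      QuotientGroup.ker_mk']
  have h3 : ⁅⁅(⊤ : Subgroup G), ⊤⁆, gamma 2 G⁆ ≤ gamma 4 G :=
    (bot_iff _ _ _).2 (Subgroup.commutator_commutator_eq_bot_of_rotate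
      ((bot_iff _ _ _).1 h1) ((bot_iff _ _ _).1 h2))
  exact h3

/-- The augmentation ideal of the integral group ring: the kernel of the ring homomorphism
`ℤ[G] → ℤ` that sends every element of `G` to `1`. -/
noncomputable def augIdeal (G : Type u) [Group G] : Ideal (MonoidAlgebra ℤ G) :=
  RingHom.ker (MonoidAlgebra.lift ℤ ℤ G (1 : G →* ℤ))

/-- The `n`-th dimension subgroup `D_n(G) = {g ∈ G | g - 1 ∈ 𝔤 ^ n}`. -/
noncomputable def dimSubgroup (n : ℕ) (G : Type u) [Group G] : Subgroup G where
  carrier := {g | MonoidAlgebra.of ℤ G g - 1 ∈ augIdeal G ^ n}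
  one_mem' := by
    change MonoidAlgebra.of ℤ G 1 - 1 ∈ augIdeal G ^ n
    rw [map_one, sub_self]
    exact zero_mem _
  mul_mem' {a b} ha hb := by
    change MonoidAlgebra.of ℤ G (a * b) - 1 ∈ augIdeal G ^ n
    have : MonoidAlgebra.of ℤ G (a * b) - 1 =
        MonoidAlgebra.of ℤ G a * (MonoidAlgebra.of ℤ G b - 1) + (MonoidAlgebra.of ℤ G a - 1) := by
      rw [map_mul]; noncomm_ring
    rw [this]
    exact add_mem (Ideal.mul_mem_left _ _ hb) ha
  inv_mem' {a} ha := by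
    change MonoidAlgebra.of ℤ G a⁻¹ - 1 ∈ augIdeal G ^ n
    have : MonoidAlgebra.of ℤ G a⁻¹ - 1 =
        (-MonoidAlgebra.of ℤ G a⁻¹) * (MonoidAlgebra.of ℤ G a - 1) := by
      rw [mul_sub, neg_mul, ← map_mul, inv_mul_cancel, map_one]; noncomm_ring
    rw [this]
    exact Ideal.mul_mem_left _ _ ha

theorem dimSubgroup_le_comap (n : ℕ) {G H : Type u} [Group G] [Group H] (f : G →* H) :
    dimSubgroup n G ≤ (dimSubgroup n H).comap f := by
  let Φ : MonoidAlgebra ℤ G →ₐ[ℤ] MonoidAlgebra ℤ H :=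
    MonoidAlgebra.lift ℤ (MonoidAlgebra ℤ H) G ((MonoidAlgebra.of ℤ H).comp f)
  have hof : ∀ g, Φ (MonoidAlgebra.of ℤ G g) = MonoidAlgebra.of ℤ H (f g) := fun g =>
    MonoidAlgebra.lift_of _ _
  have hcomp : (MonoidAlgebra.lift ℤ ℤ H (1 : H →* ℤ)).comp Φ =
      MonoidAlgebra.lift ℤ ℤ G (1 : G →* ℤ) := by
    refine MonoidAlgebra.algHom_ext (fun g => ?_) (Subsingleton.elim _ _)
    change MonoidAlgebra.lift ℤ ℤ H (1 : H →* ℤ) (Φ (MonoidAlgebra.of ℤ G g)) =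
      MonoidAlgebra.lift ℤ ℤ G (1 : G →* ℤ) (MonoidAlgebra.of ℤ G g)
    rw [hof, MonoidAlgebra.lift_of, MonoidAlgebra.lift_of]; rfl
  have h1 : ∀ x ∈ augIdeal G, Φ x ∈ augIdeal H := by
    intro x hx
    change (MonoidAlgebra.lift ℤ ℤ H (1 : H →* ℤ)).comp Φ x = 0
    rw [hcomp]
    exact hx
  have h2 : ∀ (k : ℕ), ∀ x ∈ augIdeal G ^ k, Φ x ∈ augIdeal H ^ k := by
    intro k
    induction k with
    | zero => intro x _; rw [Submodule.pow_zero, Ideal.one_eq_top]; exact Submodule.mem_top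
    | succ k ih =>
      have : augIdeal G ^ (k + 1) ≤ (augIdeal H ^ (k + 1)).comap Φ := by
        rw [Submodule.pow_succ, Submodule.pow_succ]
        refine Ideal.mul_le.2 fun r hr s hs => ?_
        rw [Ideal.mem_comap, map_mul]
        exact Ideal.mul_mem_mul (ih r hr) (h1 s hs)
      exact this
  intro g hg
  have := h2 n _ hg
  rw [map_sub, map_one, hof] at this
  exact this

theorem dimSubgroup_four_le (G : Type u) [Group G] : dimSubgroup 4 G ≤ gamma 2 G := by
  let M := Additive (Abelianization G)
  let _ : Module ℤᵐᵒᵖ M :=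
    Module.compHom M ((RingHom.id ℤ).fromOpposite fun _ _ => mul_comm _ _)
  have : IsCentralScalar ℤ M := ⟨fun _ _ => rfl⟩
  let v : G →* TrivSqZeroExt ℤ M :=
    { toFun g := 1 + TrivSqZeroExt.inr (Additive.ofMul (Abelianization.of g))
      map_one' := by simp
      map_mul' a b := by
        rw [map_mul, ofMul_mul, TrivSqZeroExt.inr_add, mul_add, add_mul, add_mul,
          TrivSqZeroExt.inr_mul_inr]
        simp [add_assoc] }
  let Φ : MonoidAlgebra ℤ G →ₐ[ℤ] TrivSqZeroExt ℤ M := MonoidAlgebra.lift ℤ _ G v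
  have hof : ∀ g, Φ (MonoidAlgebra.of ℤ G g) = v g := fun g => MonoidAlgebra.lift_of _ _
  have hcomp : (TrivSqZeroExt.fstHom ℤ ℤ M).comp Φ =
      MonoidAlgebra.lift ℤ ℤ G (1 : G →* ℤ) := by
    refine MonoidAlgebra.algHom_ext (fun g => ?_) (Subsingleton.elim _ _)
    change (Φ (MonoidAlgebra.of ℤ G g)).fst =
      MonoidAlgebra.lift ℤ ℤ G (1 : G →* ℤ) (MonoidAlgebra.of ℤ G g)
    rw [hof, MonoidAlgebra.lift_of]
    simp [v]
  have h1 : ∀ x ∈ augIdeal G, (Φ x).fst = 0 := by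
    intro x hx
    change (TrivSqZeroExt.fstHom ℤ ℤ M).comp Φ x = 0
    rw [hcomp]
    exact hx
  have h2 : augIdeal G ^ 2 ≤ RingHom.ker Φ := by
    rw [Submodule.pow_succ, Submodule.pow_one]
    refine Ideal.mul_le.2 fun r hr s hs => ?_
    rw [RingHom.mem_ker, map_mul]
    ext
    · simp [h1 r hr]
    · simp [h1 r hr, h1 s hs]
  have : (augIdeal G).IsTwoSided := inferInstanceAs (RingHom.ker _).IsTwoSided
  have h24 : augIdeal G ^ 4 ≤ augIdeal G ^ 2 :=
    (Ideal.IsTwoSided.pow_add (I := augIdeal G) 2 2).le.trans Ideal.mul_le_right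
  intro g hg
  have h4 : MonoidAlgebra.of ℤ G g - 1 ∈ augIdeal G ^ 2 :=
    h24 hg
  have h5 : Φ (MonoidAlgebra.of ℤ G g - 1) = 0 := h2 h4
  rw [map_sub, map_one, hof] at h5
  have hv : v g = 1 + TrivSqZeroExt.inr (Additive.ofMul (Abelianization.of g)) := rfl
  rw [hv, add_sub_cancel_left] at h5
  have h6 : Additive.ofMul (Abelianization.of g) = (0 : M) := by
    have := congrArg TrivSqZeroExt.snd h5
    rwa [TrivSqZeroExt.snd_zero, TrivSqZeroExt.snd_inr] at this
  have h7 : Abelianization.of g = 1 := h6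
  have h8 : g ∈ (Abelianization.of : G →* Abelianization G).ker := h7
  rw [Abelianization.ker_of] at h8
  exact h8

theorem commutator_dimSubgroup_four_le (G : Type u) [Group G] :
    ⁅dimSubgroup 4 G, dimSubgroup 4 G⁆ ≤ gamma 4 G :=
  (Subgroup.commutator_mono (dimSubgroup_four_le G) (dimSubgroup_four_le G)).trans
    (commutator_gamma_two_le G)

/-- The fourth dimension quotient `D_4(G) / γ_4(G)`, as a functor of `G`. -/
noncomputable def dimQuotFour : GrpCat.{u} ⥤ AddCommGrpCat.{u} where
  obj G := subquot (dimSubgroup 4 G) (gamma 4 G) (commutator_dimSubgroup_four_le G)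
  map f := subquotMap _ _ f.hom (dimSubgroup_le_comap 4 f.hom) (gamma_le_comap 4 f.hom)
  map_id _ := subquot_hom_ext fun _ => rfl
  map_comp _ _ := subquot_hom_ext fun _ => rfl

/-- `γ_2(G) / γ_4(G)`, as a functor of `G`. -/
def gammaQuot : GrpCat.{u} ⥤ AddCommGrpCat.{u} where
  obj G := subquot (gamma 2 G) (gamma 4 G) (commutator_gamma_two_le G)
  map f := subquotMap _ _ f.hom (gamma_le_comap 2 f.hom) (gamma_le_comap 4 f.hom)
  map_id _ := subquot_hom_ext fun _ => rfl
  map_comp _ _ := subquot_hom_ext fun _ => rfl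

/-- The inclusion `D_4(G) / γ_4(G) ⟶ γ_2(G) / γ_4(G)`. -/
noncomputable def dimQuotIncl : dimQuotFour.{u} ⟶ gammaQuot.{u} where
  app G := subquotMap (commutator_dimSubgroup_four_le G) (commutator_gamma_two_le G)
    (MonoidHom.id G) (dimSubgroup_four_le G) le_rfl
  naturality _ _ _ := subquot_hom_ext fun _ => rfl

end Series

/-! ### Free presentations and limits over them -/

/-- A free presentation of `G`: a surjective homomorphism from a free group onto `G`. -/
structure FreePresentation (G : Type u) [Group G] where
  /-- the free group -/
  F : Type u
  [group : Group F]
  [free : IsFreeGroup F]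
  /-- the projection -/
  π : F →* G
  surj : Function.Surjective π

attribute [instance] FreePresentation.group FreePresentation.free

/-- Morphisms of free presentations of `G`: homomorphisms over `G`. -/
@[ext] structure FreePresentation.Hom {G : Type u} [Group G] (P Q : FreePresentation G) where
  /-- the homomorphism of free groups -/
  f : P.F →* Q.F
  comm : ∀ x, Q.π (f x) = P.π x

/-- The category of free presentations of `G`. -/
instance (G : Type u) [Group G] : Category.{u} (FreePresentation.{u} G) where
  Hom P Q := FreePresentation.Hom P Q
  id P := ⟨MonoidHom.id P.F, fun _ => rfl⟩
  comp a b := ⟨b.f.comp a.f, fun x => (b.comm (a.f x)).trans (a.comm x)⟩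

/-- A group together with a free presentation of it. -/
structure Presentation where
  /-- the presented group -/
  G : GrpCat.{u}
  /-- its presentation -/
  P : FreePresentation G

/-- Morphisms `(F → G) ⟶ (F' → G')`: commutative squares. -/
@[ext] structure Presentation.Hom (P Q : Presentation.{u}) where
  /-- the homomorphism of free groups -/
  f : P.P.F →* Q.P.F
  /-- the homomorphism of presented groups -/
  φ : P.G ⟶ Q.G
  comm : ∀ x, Q.P.π (f x) = φ.hom (P.P.π x)

/-- The category of free presentations of varying groups. -/
instance : Category.{u} Presentation.{u} where
  Hom P Q := Presentation.Hom P Q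
  id P := ⟨MonoidHom.id P.P.F, 𝟙 P.G, fun _ => rfl⟩
  comp a b := ⟨b.f.comp a.f, a.φ ≫ b.φ, fun x =>
    (b.comm (a.f x)).trans (congrArg b.φ.hom (a.comm x))⟩

/-- The functor `(F → G) ↦ G`. -/
def presented : Presentation.{u} ⥤ GrpCat.{u} where
  obj P := P.G
  map a := a.φ

/-- The category of free presentations of the fixed group `G`, mapped into the category of all
free presentations (morphisms become squares that are the identity on `G`). -/
def fibre (G : GrpCat.{u}) : FreePresentation.{u} G ⥤ Presentation.{u} where
  obj P := ⟨G, P⟩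
  map a := ⟨a.f, 𝟙 G, a.comm⟩

section Limits

/-- The presentation of `G` on the generators `X` through `v : X → G`. -/
def presentationOf (G : GrpCat.{u}) {X : Type u} (v : X → G) (hv : Function.Surjective v) :
    FreePresentation G where
  F := FreeGroup X
  π := FreeGroup.lift v
  surj g := by
    obtain ⟨x, rfl⟩ := hv g
    exact ⟨FreeGroup.of x, FreeGroup.lift_apply_of⟩

/-- The standard presentation, on the elements of `G` as generators. -/
def std (G : GrpCat.{u}) : FreePresentation G :=
  presentationOf G (fun g : G => g) fun g => ⟨g, rfl⟩

/-- The coproduct of the standard presentation with itself. -/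
def stdTwo (G : GrpCat.{u}) : FreePresentation G :=
  presentationOf G (Sum.elim (fun g : G => g) fun g : G => g) fun g => ⟨Sum.inl g, rfl⟩

/-- Morphisms from a presentation on generators are determined by suitable values on them. -/
def descHom {G H : GrpCat.{u}} {X : Type u} (v : X → G) (hv : Function.Surjective v)
    (φ : G ⟶ H) (Q : FreePresentation H) (w : X → Q.F) (hw : ∀ x, Q.π (w x) = φ.hom (v x)) :
    (fibre G).obj (presentationOf G v hv) ⟶ (fibre H).obj Q where
  f := FreeGroup.lift w
  φ := φ
  comm := by
    have : Q.π.comp (FreeGroup.lift w) = φ.hom.comp (FreeGroup.lift v) :=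
      FreeGroup.ext_hom _ _ fun x => by
        simp only [MonoidHom.comp_apply, FreeGroup.lift_apply_of, hw]
    exact DFunLike.congr_fun this

theorem hom_ext_of {G H : GrpCat.{u}} {X : Type u} {v : X → G} {hv : Function.Surjective v}
    {Q : FreePresentation H} {a b : (fibre G).obj (presentationOf G v hv) ⟶ (fibre H).obj Q}
    (hφ : a.φ = b.φ) (hf : ∀ x, a.f (FreeGroup.of x) = b.f (FreeGroup.of x)) : a = b :=
  Presentation.Hom.ext (FreeGroup.ext_hom _ _ hf) hφ

/-- The first coproduct inclusion. -/
def stdInl (G : GrpCat.{u}) : std G ⟶ stdTwo G :=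
  let d := descHom (fun g : G => g) (fun g => ⟨g, rfl⟩) (𝟙 G) (stdTwo G)
    (fun g => FreeGroup.of (Sum.inl g)) fun _ => FreeGroup.lift_apply_of
  ⟨d.f, d.comm⟩

/-- The second coproduct inclusion. -/
def stdInr (G : GrpCat.{u}) : std G ⟶ stdTwo G :=
  let d := descHom (fun g : G => g) (fun g => ⟨g, rfl⟩) (𝟙 G) (stdTwo G)
    (fun g => FreeGroup.of (Sum.inr g)) fun _ => FreeGroup.lift_apply_of
  ⟨d.f, d.comm⟩

/-- A homomorphism `φ : G ⟶ H` lifts to a morphism from the standard presentation of `G` to any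
free presentation of `H`. -/
noncomputable def stdLift {G H : GrpCat.{u}} (φ : G ⟶ H) (Q : FreePresentation H) :
    (fibre G).obj (std G) ⟶ (fibre H).obj Q :=
  descHom _ _ φ Q (fun g => (Q.surj (φ.hom g)).choose) fun g => (Q.surj (φ.hom g)).choose_spec

/-- Two lifts of `φ` are jointly induced by a lift from the coproduct. -/
theorem exists_copair {G H : GrpCat.{u}} {Q : FreePresentation H}
    (a b : (fibre G).obj (std G) ⟶ (fibre H).obj Q) (hab : a.φ = b.φ) :
    ∃ c : (fibre G).obj (stdTwo G) ⟶ (fibre H).obj Q,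
      (fibre G).map (stdInl G) ≫ c = a ∧ (fibre G).map (stdInr G) ≫ c = b := by
  have ha : ∀ g : G, Q.π (a.f (FreeGroup.of g)) = a.φ.hom g := fun g =>
    (a.comm _).trans (congrArg a.φ.hom FreeGroup.lift_apply_of)
  have hb : ∀ g : G, Q.π (b.f (FreeGroup.of g)) = a.φ.hom g := fun g =>
    hab ▸ (b.comm _).trans (congrArg b.φ.hom FreeGroup.lift_apply_of)
  let w : G ⊕ G → Q.F :=
    Sum.elim (fun g => a.f (FreeGroup.of g)) fun g => b.f (FreeGroup.of g)
  have hw : ∀ x, Q.π (w x) = a.φ.hom (Sum.elim (fun g : G => g) (fun g : G => g) x) := by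
    rintro (g | g)
    · exact ha g
    · exact hb g
  have hL : ∀ x, FreeGroup.lift w (FreeGroup.of x) = w x := fun x => FreeGroup.lift_apply_of
  refine ⟨descHom _ _ a.φ Q w hw, hom_ext_of (Category.id_comp _) fun g => ?_,
    hom_ext_of ((Category.id_comp _).trans hab) fun g => ?_⟩
  · exact (congrArg (FreeGroup.lift w) FreeGroup.lift_apply_of).trans (hL _)
  · exact (congrArg (FreeGroup.lift w) FreeGroup.lift_apply_of).trans (hL _)

variable (T : Presentation.{u} ⥤ AddCommGrpCat.{u})

theorem comp_eq_of_lift {A : AddCommGrpCat.{u}} {G H : GrpCat.{u}} {Q : FreePresentation H}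
    (s : A ⟶ T.obj ((fibre G).obj (std G)))
    (hs : s ≫ T.map ((fibre G).map (stdInl G)) = s ≫ T.map ((fibre G).map (stdInr G)))
    (a b : (fibre G).obj (std G) ⟶ (fibre H).obj Q) (hab : a.φ = b.φ) :
    s ≫ T.map a = s ≫ T.map b := by
  obtain ⟨c, rfl, rfl⟩ := exists_copair a b hab
  rw [T.map_comp, T.map_comp, reassoc_of% hs]

theorem cone_inl_eq_inr {G : GrpCat.{u}} (s : Cone (fibre G ⋙ T)) :
    s.π.app (std G) ≫ T.map ((fibre G).map (stdInl G)) =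
      s.π.app (std G) ≫ T.map ((fibre G).map (stdInr G)) :=
  (s.w (stdInl G)).trans (s.w (stdInr G)).symm

/-- A morphism of presentations of a fixed group, from a square that is the identity on it. -/
def ofSquare {G : GrpCat.{u}} {P Q : FreePresentation G}
    (a : (fibre G).obj P ⟶ (fibre G).obj Q) (ha : a.φ = 𝟙 G) : P ⟶ Q where
  f := a.f
  comm x := (a.comm x).trans (by rw [ha]; rfl)

theorem fibre_map_ofSquare {G : GrpCat.{u}} {P Q : FreePresentation G}
    (a : (fibre G).obj P ⟶ (fibre G).obj Q) (ha : a.φ = 𝟙 G) :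
    (fibre G).map (ofSquare a ha) = a :=
  Presentation.Hom.ext rfl ha.symm

theorem cone_std {G : GrpCat.{u}} (s : Cone (fibre G ⋙ T)) {Q : FreePresentation G}
    (a : (fibre G).obj (std G) ⟶ (fibre G).obj Q) (ha : a.φ = 𝟙 G) :
    s.π.app (std G) ≫ T.map a = s.π.app Q := by
  have := s.w (ofSquare a ha)
  rwa [Functor.comp_map, fibre_map_ofSquare] at this

/-- Limits over the (large) category of free presentations of `G` exist. -/
instance hasLimit_fibre (G : GrpCat.{u}) : HasLimit (fibre G ⋙ T) := by
  let i := T.map ((fibre G).map (stdInl G))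
  let j := T.map ((fibre G).map (stdInr G))
  let c : Cone (fibre G ⋙ T) :=
    { pt := equalizer i j
      π :=
        { app Q := equalizer.ι i j ≫ T.map (stdLift (𝟙 G) Q)
          naturality Q Q' a := by
            have := comp_eq_of_lift T (equalizer.ι i j) (equalizer.condition i j)
              (stdLift (𝟙 G) Q') (stdLift (𝟙 G) Q ≫ (fibre G).map a)
              (Category.id_comp (𝟙 G)).symm
            simpa using this } }
  have hι : c.π.app (std G) = equalizer.ι i j :=
    (comp_eq_of_lift T (equalizer.ι i j) (equalizer.condition i j)
      (stdLift (𝟙 G) (std G)) (𝟙 _) rfl).trans (by simp)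
  exact ⟨⟨c,
    { lift s := equalizer.lift (s.π.app (std G)) (cone_inl_eq_inr T s)
      fac s Q := by
        change equalizer.lift _ _ ≫ equalizer.ι i j ≫ T.map (stdLift (𝟙 G) Q) = _
        rw [equalizer.lift_ι_assoc]
        exact cone_std T s _ rfl
      uniq s m hm := by
        apply equalizer.hom_ext
        rw [equalizer.lift_ι, ← hm (std G), hι] }⟩⟩

theorem freeLim_naturality {G H : GrpCat.{u}} (φ : G ⟶ H) {Q Q' : FreePresentation H}
    (a : Q ⟶ Q') :
    (limit.π (fibre G ⋙ T) (std G) ≫ T.map (stdLift φ Q)) ≫ T.map ((fibre H).map a) =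
      limit.π (fibre G ⋙ T) (std G) ≫ T.map (stdLift φ Q') := by
  rw [Category.assoc, ← T.map_comp]
  exact comp_eq_of_lift T _ (cone_inl_eq_inr T (limit.cone _)) _ _ (Category.comp_id φ)

/-- The map `lim T(F → G) ⟶ lim T(F' → H)` induced by `φ : G ⟶ H`; it is compatible with every
square over `φ`. -/
noncomputable def freeLimMap {G H : GrpCat.{u}} (φ : G ⟶ H) :
    limit (fibre G ⋙ T) ⟶ limit (fibre H ⋙ T) :=
  limit.lift (fibre H ⋙ T)
    { pt := limit (fibre G ⋙ T)
      π :=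
        { app Q := limit.π (fibre G ⋙ T) (std G) ≫ T.map (stdLift φ Q)
          naturality _ _ a := (Category.id_comp _).trans (freeLim_naturality T φ a).symm } }

theorem freeLimMap_π {G H : GrpCat.{u}} (φ : G ⟶ H) {P : FreePresentation G}
    {Q : FreePresentation H} (a : (fibre G).obj P ⟶ (fibre H).obj Q) (ha : a.φ = φ) :
    freeLimMap T φ ≫ limit.π (fibre H ⋙ T) Q = limit.π (fibre G ⋙ T) P ≫ T.map a := by
  have h1 : freeLimMap T φ ≫ limit.π (fibre H ⋙ T) Q =
      limit.π (fibre G ⋙ T) (std G) ≫ T.map (stdLift φ Q) := limit.lift_π _ _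
  have h2 : limit.π (fibre G ⋙ T) (std G) ≫ T.map (stdLift (𝟙 G) P) =
      limit.π (fibre G ⋙ T) P := cone_std T (limit.cone _) _ rfl
  rw [h1, ← h2, Category.assoc, ← T.map_comp]
  exact comp_eq_of_lift T _ (cone_inl_eq_inr T (limit.cone _)) _ _
    (ha.symm.trans (Category.id_comp a.φ).symm)

/-- The functor `G ↦ lim T(F → G)`, the limit being taken over the category of free
presentations of the fixed group `G`. -/
noncomputable def freeLim : GrpCat.{u} ⥤ AddCommGrpCat.{u} where
  obj G := limit (fibre G ⋙ T)
  map φ := freeLimMap T φ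
  map_id G := limit.hom_ext fun Q => by
    rw [freeLimMap_π T (𝟙 G) (𝟙 ((fibre G).obj Q)) rfl, T.map_id, Category.id_comp]
    exact Category.comp_id _
  map_comp {G H K} φ ψ := limit.hom_ext fun Q => by
    rw [freeLimMap_π T (φ ≫ ψ) (stdLift φ (std H) ≫ stdLift ψ Q) rfl, Category.assoc,
      freeLimMap_π T ψ (stdLift ψ Q) rfl, T.map_comp, ← Category.assoc, ← Category.assoc,
      freeLimMap_π T φ (stdLift φ (std H)) rfl]

/-- The projection `lim T(F → G) ⟶ T(F → G)`. -/
noncomputable def freeLimProj (G : GrpCat.{u}) (P : FreePresentation G) :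
    (freeLim T).obj G ⟶ T.obj ⟨G, P⟩ :=
  limit.π (fibre G ⋙ T) P

theorem limMap_comp_π {T T' : Presentation.{u} ⥤ AddCommGrpCat.{u}} (α : T ⟶ T')
    (G : GrpCat.{u}) (P : FreePresentation G) :
    limMap (Functor.whiskerLeft (fibre G) α) ≫ limit.π (fibre G ⋙ T') P =
      limit.π (fibre G ⋙ T) P ≫ α.app ((fibre G).obj P) := limMap_π _ _

/-- The map on limits induced by a natural transformation. -/
noncomputable def freeLimHom {T T' : Presentation.{u} ⥤ AddCommGrpCat.{u}} (α : T ⟶ T') :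
    freeLim T ⟶ freeLim T' where
  app G := limMap (Functor.whiskerLeft (fibre G) α)
  naturality G H φ := by
    change freeLimMap T φ ≫ limMap (Functor.whiskerLeft (fibre H) α) =
      limMap (Functor.whiskerLeft (fibre G) α) ≫ freeLimMap T' φ
    refine limit.hom_ext fun Q => ?_
    rw [Category.assoc, Category.assoc, limMap_comp_π,
      freeLimMap_π T' φ (stdLift φ Q) rfl, ← Category.assoc, ← Category.assoc,
      freeLimMap_π T φ (stdLift φ Q) rfl, limMap_comp_π, Category.assoc, Category.assoc,
      α.naturality]

end Limits

/-! ### The two functors of free presentations -/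

section Functors

/-- The kernel `R` of a free presentation `R ↪ F ↠ G`. -/
abbrev rel (P : Presentation.{u}) : Subgroup P.P.F := P.P.π.ker

theorem rel_le_comap {P Q : Presentation.{u}} (a : P ⟶ Q) : rel P ≤ (rel Q).comap a.f :=
  fun x hx => by
    have hx' : P.P.π x = 1 := hx
    change Q.P.π (a.f x) = 1
    rw [a.comm, hx', map_one]

theorem commutator_rel_le_comap {P Q : Presentation.{u}} (a : P ⟶ Q) :
    ⁅rel P, rel P⁆ ≤ ⁅rel Q, rel Q⁆.comap a.f := by
  rw [← Subgroup.map_le_iff_le_comap, Subgroup.map_commutator]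
  have := Subgroup.map_le_iff_le_comap.2 (rel_le_comap a)
  exact Subgroup.commutator_mono this this

theorem sup_le_comap {F F' : Type u} [Group F] [Group F'] {f : F →* F'} {A B : Subgroup F}
    {A' B' : Subgroup F'} (hA : A ≤ A'.comap f) (hB : B ≤ B'.comap f) :
    A ⊔ B ≤ (A' ⊔ B').comap f :=
  sup_le (hA.trans (Subgroup.comap_mono le_sup_left)) (hB.trans (Subgroup.comap_mono le_sup_right))

/-- The functor `(R ↪ F ↠ G) ↦ (R ∩ γ_2(F)) / (γ_2(R) (R ∩ γ_4(F)))`. The product of the two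
normal subgroups is their join `⊔`. -/
def relQuot : Presentation.{u} ⥤ AddCommGrpCat.{u} where
  obj P := subquot (rel P ⊓ gamma 2 P.P.F) (⁅rel P, rel P⁆ ⊔ (rel P ⊓ gamma 4 P.P.F))
    ((Subgroup.commutator_mono inf_le_left inf_le_left).trans le_sup_left)
  map a := subquotMap _ _ a.f
    (inf_le_inf (rel_le_comap a) (gamma_le_comap 2 a.f))
    (sup_le_comap (commutator_rel_le_comap a)
      (inf_le_inf (rel_le_comap a) (gamma_le_comap 4 a.f)))
  map_id _ := subquot_hom_ext fun _ => rfl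
  map_comp _ _ := subquot_hom_ext fun _ => rfl

/-- The functor `(R ↪ F ↠ G) ↦ γ_2(F) / (γ_2(R) γ_4(F))`. -/
def freeQuot : Presentation.{u} ⥤ AddCommGrpCat.{u} where
  obj P := subquot (gamma 2 P.P.F) (⁅rel P, rel P⁆ ⊔ gamma 4 P.P.F)
    ((commutator_gamma_two_le _).trans le_sup_right)
  map a := subquotMap _ _ a.f (gamma_le_comap 2 a.f)
    (sup_le_comap (commutator_rel_le_comap a) (gamma_le_comap 4 a.f))
  map_id _ := subquot_hom_ext fun _ => rfl
  map_comp _ _ := subquot_hom_ext fun _ => rfl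

/-- The map induced by the inclusion `R ∩ γ_2(F) ≤ γ_2(F)`. -/
def relIncl : relQuot.{u} ⟶ freeQuot.{u} where
  app P := subquotMap _ _ (MonoidHom.id P.P.F) inf_le_right
    (sup_le_sup le_rfl inf_le_right)
  naturality _ _ _ := subquot_hom_ext fun _ => rfl

/-- The map `γ_2(F) / (γ_2(R) γ_4(F)) ⟶ γ_2(G) / γ_4(G)` induced by `F ↠ G`. -/
def freeProj : freeQuot.{u} ⟶ presented.{u} ⋙ gammaQuot.{u} where
  app P := subquotMap _ (commutator_gamma_two_le P.G) P.P.π (gamma_le_comap 2 P.P.π)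
    (sup_le ((Subgroup.commutator_le_left _ _).trans fun x hx => by
      have hx' : P.P.π x = 1 := hx
      rw [Subgroup.mem_comap, hx']
      exact one_mem _) (gamma_le_comap 4 P.P.π))
  naturality P Q a := subquot_hom_ext fun x =>
    congrArg (subquotMk (gamma 2 Q.G) (gamma 4 Q.G) (commutator_gamma_two_le Q.G))
      (Subtype.ext (a.comm x))

end Functors

end DimQuot

namespace DimQuot


/-! ### Group rings, augmentation powers and the relation ideal. -/

section GroupRing

variable {F : Type u} [Group F]

/-! For each presentation, relQuot is the kernel of freeQuot → γ_2(G)/γ_4(G), and the target does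
not depend on the presentation. Limits are left exact, so lim relQuot is the kernel of lim freeQuot
→ γ_2(G)/γ_4(G). What remains is that the image of this map is D_4(G)/γ_4(G).

The limit consists of the classes at the standard presentation on which the two coproduct inclusions
i₁, i₂ agree. So g lies in the image iff it has a lift x ∈ γ_2(F) with i₁(x) ≡ i₂(x) modulo
[R',R']γ_4(F'), where R' ↪ F' ↠ G is the coproduct. Both directions use affine actions (m, k) ↦ (um
+ kδ(u), k) built from a crossed homomorphism δ, and a filtration that each u - 1 shifts by one step
(`map_mem_of_mem_augIdeal_pow`).

If g ∈ D_4(G), a lift x can be chosen with x - 1 in (R - 1)(F - 1) + 𝔣^4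
(`exists_lift_mem_relAug_sup`). The crossed homomorphism δ(u) = i₁(u)i₂(u)⁻¹ into the abelianization
of R' shows that x works (`mul_inv_mem_of_mem_relAug_sup`).

Conversely, let F' act on ℤ[G] × ℤ, the first copy of G through δ(g) = g - 1 and the second through
δ = 0. Then [R',R'] acts trivially and γ_4(F') moves (0, 1) only by 𝔤^4, which forces g - 1 ∈ 𝔤^4
(`lift_mem_dimSubgroup`). -/

theorem of_sub_one_mem_augIdeal (u : F) : MonoidAlgebra.of ℤ F u - 1 ∈ augIdeal F := by
  change MonoidAlgebra.lift ℤ ℤ F (1 : F →* ℤ) _ = 0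
  rw [map_sub, MonoidAlgebra.lift_of]
  simp

instance augIdeal_isTwoSided : (augIdeal F).IsTwoSided :=
  inferInstanceAs (RingHom.ker _).IsTwoSided

/-- Augmentation powers act through a filtration that every `u - 1` shifts by one step. -/
theorem map_mem_of_mem_augIdeal_pow {E : Type*} [AddCommGroup E]
    (Ψ : MonoidAlgebra ℤ F →ₐ[ℤ] Module.End ℤ E) {S : ℕ → Submodule ℤ E}
    (hanti : ∀ k, S (k + 1) ≤ S k)
    (hS : ∀ k u, ∀ m ∈ S k, Ψ (MonoidAlgebra.of ℤ F u) m - m ∈ S (k + 1)) {k : ℕ} :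
    ∀ {j : ℕ} {z : MonoidAlgebra ℤ F} {m : E}, z ∈ augIdeal F ^ k → m ∈ S j →
      Ψ z m ∈ S (j + k) := by
  -- On each layer S j / S (j + 1) the group acts trivially, so the group ring acts through its
  -- augmentation.
  have key : ∀ (j : ℕ) (m : E), m ∈ S j → ∀ z : MonoidAlgebra ℤ F,
      Ψ z m - MonoidAlgebra.lift ℤ ℤ F (1 : F →* ℤ) z • m ∈ S (j + 1) := by
    intro j m hm z
    induction z using MonoidAlgebra.induction_on with
    | of u =>
      rw [MonoidAlgebra.lift_of]
      simpa using hS j u m hm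
    | add x y hx hy =>
      have := add_mem hx hy
      rw [map_add, map_add, add_smul, LinearMap.add_apply]
      convert this using 1
      abel
    | smul r x hx =>
      have := (S (j + 1)).smul_mem r hx
      rwa [smul_sub, ← LinearMap.smul_apply, ← map_smul, smul_smul, ← smul_eq_mul,
        ← map_smul] at this
  induction k with
  | zero =>
    intro j z m _ hm
    have := add_mem (hanti j (key j m hm z))
      ((S j).smul_mem (MonoidAlgebra.lift ℤ ℤ F (1 : F →* ℤ) z) hm)
    simpa using this
  | succ k ih =>
    intro j z m hz hm
    rw [Submodule.pow_succ] at hz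
    refine Submodule.mul_induction_on hz (fun r hr s hs => ?_) fun x y hx hy => ?_
    · rw [map_mul, Module.End.mul_apply, add_comm k, ← add_assoc]
      refine ih hr ?_
      have h0 : MonoidAlgebra.lift ℤ ℤ F (1 : F →* ℤ) s = 0 := hs
      simpa [h0] using key j m hm s
    · rw [map_add, LinearMap.add_apply]
      exact add_mem hx hy

/-- Induction through the identity [a,b] - 1 = ((a - 1)(b - 1) - (b - 1)(a - 1)) a⁻¹b⁻¹. -/
theorem gamma_succ_le_dimSubgroup (n : ℕ) : gamma (n + 1) F ≤ dimSubgroup (n + 1) F := by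
  induction n with
  | zero =>
    intro x _
    change _ ∈ augIdeal F ^ 1
    rw [Submodule.pow_one]
    exact of_sub_one_mem_augIdeal x
  | succ n ih =>
    refine Subgroup.commutator_le.2 fun a ha b _ => ?_
    have ha' : MonoidAlgebra.of ℤ F a - 1 ∈ augIdeal F ^ (n + 1) := ih ha
    have hb := of_sub_one_mem_augIdeal b
    change MonoidAlgebra.of ℤ F ⁅a, b⁆ - 1 ∈ augIdeal F ^ (n + 1 + 1)
    have h : MonoidAlgebra.of ℤ F ⁅a, b⁆ - 1 =
        ((MonoidAlgebra.of ℤ F a - 1) * (MonoidAlgebra.of ℤ F b - 1) -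
          (MonoidAlgebra.of ℤ F b - 1) * (MonoidAlgebra.of ℤ F a - 1)) *
            MonoidAlgebra.of ℤ F (a⁻¹ * b⁻¹) := by
      have h1 : MonoidAlgebra.of ℤ F ⁅a, b⁆ =
          MonoidAlgebra.of ℤ F a * MonoidAlgebra.of ℤ F b * MonoidAlgebra.of ℤ F (a⁻¹ * b⁻¹) := by
        simp only [← map_mul, commutatorElement_def, mul_assoc]
      have h2 : MonoidAlgebra.of ℤ F b * MonoidAlgebra.of ℤ F a *
          MonoidAlgebra.of ℤ F (a⁻¹ * b⁻¹) = 1 := by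
        rw [← map_mul, ← map_mul, ← map_one (MonoidAlgebra.of ℤ F)]
        congr 1
        group
      calc _ = MonoidAlgebra.of ℤ F a * MonoidAlgebra.of ℤ F b * MonoidAlgebra.of ℤ F (a⁻¹ * b⁻¹) -
            MonoidAlgebra.of ℤ F b * MonoidAlgebra.of ℤ F a *
              MonoidAlgebra.of ℤ F (a⁻¹ * b⁻¹) := by rw [h1, h2]
        _ = _ := by noncomm_ring
    rw [h]
    refine Ideal.mul_mem_right _ _ (sub_mem ?_ ?_)
    · rw [Submodule.pow_succ]
      exact Ideal.mul_mem_mul ha' hb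
    · rw [Submodule.pow_succ']
      · exact Ideal.mul_mem_mul hb ha'
      · omega

variable {G : Type u} [Group G] (π : F →* G)

/-- The ring homomorphism `ℤ[F] → ℤ[G]` induced by `F → G`. -/
noncomputable def groupRingMap : MonoidAlgebra ℤ F →ₐ[ℤ] MonoidAlgebra ℤ G :=
  MonoidAlgebra.lift ℤ (MonoidAlgebra ℤ G) F ((MonoidAlgebra.of ℤ G).comp π)

theorem groupRingMap_of (u : F) :
    groupRingMap π (MonoidAlgebra.of ℤ F u) = MonoidAlgebra.of ℤ G (π u) :=
  MonoidAlgebra.lift_of _ _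

theorem augmentation_groupRingMap (z : MonoidAlgebra ℤ F) :
    MonoidAlgebra.lift ℤ ℤ G (1 : G →* ℤ) (groupRingMap π z) =
      MonoidAlgebra.lift ℤ ℤ F (1 : F →* ℤ) z := by
  induction z using MonoidAlgebra.induction_on with
  | of u => rw [groupRingMap_of, MonoidAlgebra.lift_of, MonoidAlgebra.lift_of]; rfl
  | add x y hx hy => rw [map_add, map_add, map_add, hx, hy]
  | smul r x hx => rw [map_smul, map_smul, map_smul, hx]

variable {π}

theorem groupRingMap_surjective (hπ : Function.Surjective π) :
    Function.Surjective (groupRingMap π) := by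
  intro z
  induction z using MonoidAlgebra.induction_on with
  | of g =>
    obtain ⟨u, rfl⟩ := hπ g
    exact ⟨_, groupRingMap_of π u⟩
  | add x y hx hy =>
    obtain ⟨a, rfl⟩ := hx
    obtain ⟨b, rfl⟩ := hy
    exact ⟨a + b, map_add _ _ _⟩
  | smul r x hx =>
    obtain ⟨a, rfl⟩ := hx
    exact ⟨r • a, map_smul _ _ _⟩

theorem exists_mem_augIdeal_pow (hπ : Function.Surjective π) (k : ℕ) :
    ∀ z ∈ augIdeal G ^ k, ∃ w ∈ augIdeal F ^ k, groupRingMap π w = z := by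
  induction k with
  | zero =>
    intro z _
    obtain ⟨w, hw⟩ := groupRingMap_surjective hπ z
    exact ⟨w, by rw [Submodule.pow_zero, Ideal.one_eq_top]; exact Submodule.mem_top, hw⟩
  | succ k ih =>
    intro z hz
    rw [Submodule.pow_succ] at hz
    refine Submodule.mul_induction_on hz (fun r hr s hs => ?_) fun x y hx hy => ?_
    · obtain ⟨r', hr', rfl⟩ := ih r hr
      obtain ⟨s', rfl⟩ := groupRingMap_surjective hπ s
      refine ⟨r' * s', ?_, map_mul _ _ _⟩
      rw [Submodule.pow_succ]
      exact Ideal.mul_mem_mul hr' ((augmentation_groupRingMap π s').symm.trans hs)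
    · obtain ⟨x', hx', rfl⟩ := hx
      obtain ⟨y', hy', rfl⟩ := hy
      exact ⟨x' + y', add_mem hx' hy', map_add _ _ _⟩

variable (π) in
/-- The additive span of the products `(r - 1)(v - 1)` with `r` in the kernel of `π`; this is
the product of the relation ideal with the augmentation ideal. -/
noncomputable def relAug : AddSubgroup (MonoidAlgebra ℤ F) :=
  AddSubgroup.closure {z | ∃ r ∈ π.ker, ∃ v : F,
    z = (MonoidAlgebra.of ℤ F r - 1) * (MonoidAlgebra.of ℤ F v - 1)}

theorem mul_mem_relAug {r : F} (hr : r ∈ π.ker) (v : F) :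
    (MonoidAlgebra.of ℤ F r - 1) * (MonoidAlgebra.of ℤ F v - 1) ∈ relAug π :=
  AddSubgroup.subset_closure ⟨r, hr, v, rfl⟩

variable (π) in
/-- The elements that agree with some `r - 1`, `r` in the kernel of `π`, modulo `relAug π`. -/
noncomputable def relSubOne : AddSubgroup (MonoidAlgebra ℤ F) where
  carrier := {z | ∃ r ∈ π.ker, z - (MonoidAlgebra.of ℤ F r - 1) ∈ relAug π}
  zero_mem' := ⟨1, one_mem _, by rw [map_one, sub_self, sub_self]; exact zero_mem _⟩
  add_mem' := by
    rintro x y ⟨r, hr, hx⟩ ⟨s, hs, hy⟩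
    -- rs - 1 = (r - 1) + (s - 1) + (r - 1)(s - 1), so r ↦ r - 1 is additive modulo `relAug π`.
    refine ⟨r * s, mul_mem hr hs, ?_⟩
    have := sub_mem (add_mem hx hy) (mul_mem_relAug hr s)
    convert this using 1
    rw [map_mul]
    noncomm_ring
  neg_mem' := by
    rintro x ⟨r, hr, hx⟩
    refine ⟨r⁻¹, inv_mem hr, ?_⟩
    have := sub_mem (mul_mem_relAug hr r⁻¹) hx
    have h1 : MonoidAlgebra.of ℤ F r * MonoidAlgebra.of ℤ F r⁻¹ = 1 := by
      rw [← map_mul, mul_inv_cancel, map_one]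
    convert this using 1
    rw [mul_sub, sub_mul, h1]
    noncomm_ring

/-- For a set-theoretic section s of π, write u = r s(π u) with r in the kernel. Then u - s(π u) =
(r - 1) + (r - 1)(s(π u) - 1). By linearity z minus the lift of its image lies in `relSubOne π`, and
that lift vanishes here. -/
theorem mem_relSubOne_of_map_eq_zero (hπ : Function.Surjective π) {z : MonoidAlgebra ℤ F}
    (hz : groupRingMap π z = 0) : z ∈ relSubOne π := by
  let s : G → F := fun g => (hπ g).choose
  have hs : ∀ g, π (s g) = g := fun g => (hπ g).choose_spec
  let σ : MonoidAlgebra ℤ G →+ MonoidAlgebra ℤ F :=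
    MonoidAlgebra.liftNC (Int.castAddHom _) fun g => MonoidAlgebra.of ℤ F (s g)
  have hσ : ∀ g, σ (MonoidAlgebra.of ℤ G g) = MonoidAlgebra.of ℤ F (s g) := fun g => by
    rw [MonoidAlgebra.of_apply]
    exact (MonoidAlgebra.liftNC_single _ _ _ _).trans (by simp)
  have key : ∀ z, z - σ (groupRingMap π z) ∈ relSubOne π := by
    intro z
    induction z using MonoidAlgebra.induction_on with
    | of u =>
      rw [groupRingMap_of, hσ]
      have hr : u * (s (π u))⁻¹ ∈ π.ker := by
        rw [MonoidHom.mem_ker, map_mul, map_inv, hs, mul_inv_cancel]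
      refine ⟨_, hr, ?_⟩
      have := mul_mem_relAug hr (s (π u))
      convert this using 1
      have h1 : MonoidAlgebra.of ℤ F (u * (s (π u))⁻¹) * MonoidAlgebra.of ℤ F (s (π u)) =
          MonoidAlgebra.of ℤ F u := by
        rw [← map_mul, inv_mul_cancel_right]
      rw [mul_sub, sub_mul, h1]
      noncomm_ring
    | add x y hx hy =>
      have := add_mem hx hy
      rw [map_add, map_add]
      convert this using 1
      abel
    | smul r x hx =>
      have := (relSubOne π).zsmul_mem hx r
      rwa [smul_sub, ← map_zsmul, ← map_zsmul] at this
  simpa [hz] using key z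

/-- Every element of the dimension subgroup of `G` lifts to an element `x` of `F` with `x - 1`
in the sum of `relAug π` and the augmentation power. -/
theorem exists_lift_mem_relAug_sup (hπ : Function.Surjective π) {n : ℕ} {g : G}
    (hg : g ∈ dimSubgroup n G) :
    ∃ x : F, π x = g ∧
      MonoidAlgebra.of ℤ F x - 1 ∈ relAug π ⊔ (augIdeal F ^ n).toAddSubgroup := by
  obtain ⟨y, rfl⟩ := hπ g
  obtain ⟨w, hw, hwg⟩ := exists_mem_augIdeal_pow hπ n _ hg
  obtain ⟨r, hr, hJ⟩ := mem_relSubOne_of_map_eq_zero hπ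
    (z := MonoidAlgebra.of ℤ F y - 1 - w) (by
      rw [map_sub, hwg, map_sub, groupRingMap_of, map_one, sub_self])
  -- Dividing y by r removes the term r - 1, up to the element (r - 1)(r⁻¹y - 1) of `relAug π`.
  refine ⟨r⁻¹ * y, by rw [map_mul, map_inv, MonoidHom.mem_ker.1 hr, inv_one, one_mul], ?_⟩
  have h1 : MonoidAlgebra.of ℤ F r * MonoidAlgebra.of ℤ F (r⁻¹ * y) =
      MonoidAlgebra.of ℤ F y := by
    rw [← map_mul, mul_inv_cancel_left]
  refine AddSubgroup.mem_sup.2 ⟨_, sub_mem hJ (mul_mem_relAug hr (r⁻¹ * y)), w, hw, ?_⟩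
  rw [mul_sub, sub_mul, h1]
  noncomm_ring

end GroupRing


/-! ### Affine actions from crossed homomorphisms. -/

section CrossedAction

variable {F : Type*} [Group F] {M : Type*} [AddCommGroup M]

/-- The action of `F` on `M × ℤ` by `u (m, n) = (u m + n δ(u), n)`, for a crossed homomorphism
`δ : F → M`. -/
def crossedAction (ρ : F →* Module.End ℤ M) (δ : F → M)
    (hδ : ∀ u v, δ (u * v) = δ u + ρ u (δ v)) : F →* Module.End ℤ (M × ℤ) where
  toFun u := ((ρ u).coprod (LinearMap.toSpanSingleton ℤ M (δ u))).prod (LinearMap.snd ℤ M ℤ)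
  map_one' := by
    have h1 : δ 1 = 0 := by simpa using hδ 1 1
    ext <;> simp [h1]
  map_mul' u v := by
    refine LinearMap.ext fun p => ?_
    ext
    · simp [hδ]
      abel
    · simp

theorem crossedAction_apply (ρ : F →* Module.End ℤ M) (δ : F → M)
    (hδ : ∀ u v, δ (u * v) = δ u + ρ u (δ v)) (u : F) (m : M) (n : ℤ) :
    crossedAction ρ δ hδ u (m, n) = (ρ u m + n • δ u, n) := rfl

end CrossedAction

/-! ### Dimension subgroups and the comparison of two lifts. -/

section Lifts

variable {F F' G : Type u} [Group F] [Group F'] [Group G]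

/-- Two homomorphisms that agree modulo a normal subgroup `R'` differ, on elements `x` with
`x - 1` in the sum of `relAug π` and the augmentation power, by an element of `[R', R'] γ(F')`. -/
theorem mul_inv_mem_of_mem_relAug_sup (π : F →* G) (a b : F →* F') (R' : Subgroup F') [R'.Normal]
    (hab : ∀ u, a u * (b u)⁻¹ ∈ R') (ha : ∀ r ∈ π.ker, a r ∈ R') {n : ℕ} {x : F}
    (hx : MonoidAlgebra.of ℤ F x - 1 ∈ relAug π ⊔ (augIdeal F ^ (n + 1)).toAddSubgroup) :
    a x * (b x)⁻¹ ∈ ⁅R', R'⁆ ⊔ gamma (n + 1) F' := by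
  let M := Additive (Abelianization R')
  let ι : R' → M := fun r => Additive.ofMul (Abelianization.of r)
  have ι_mul : ∀ r s, ι (r * s) = ι r + ι s := fun r s => rfl
  have ι_surj : ∀ m, ∃ r, ι r = m := fun m => QuotientGroup.mk_surjective (Additive.toMul m)
  let ρ : F →* Module.End ℤ M :=
    { toFun u := (MonoidHom.toAdditive
        (Abelianization.map (MulAut.conjNormal (a u)).toMonoidHom)).toIntLinearMap
      map_one' := by
        refine LinearMap.ext fun m => ?_
        obtain ⟨r, rfl⟩ := ι_surj m
        exact congrArg ι (Subtype.ext (by simp))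
      map_mul' u v := by
        refine LinearMap.ext fun m => ?_
        obtain ⟨r, rfl⟩ := ι_surj m
        exact congrArg ι (Subtype.ext (by simp)) }
  -- With F acting on M by conjugation through a, this is crossed: a(uv)b(uv)⁻¹ is the
  -- a(u)-conjugate of a(v)b(v)⁻¹, times a(u)b(u)⁻¹.
  let δ : F → M := fun u => ι ⟨a u * (b u)⁻¹, hab u⟩
  have hδ : ∀ u v, δ (u * v) = δ u + ρ u (δ v) := by
    intro u v
    rw [add_comm]
    change ι _ = ι (MulAut.conjNormal (a u) _) + ι _
    rw [← ι_mul]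
    congr 1
    apply Subtype.ext
    simp [mul_assoc]
  let N : ℕ → Submodule ℤ M := fun k => AddSubgroup.toIntSubmodule
    (Subgroup.toAddSubgroup (((gamma k F').subgroupOf R').map Abelianization.of))
  have mem_N : ∀ {k m}, m ∈ N k ↔ ∃ r : R', (r : F') ∈ gamma k F' ∧ ι r = m := Iff.rfl
  -- Level 0 must contain (0, 1). One step kills the ℤ-coordinate, and from there on the lower
  -- central series of F' filters M.
  let S : ℕ → Submodule ℤ (M × ℤ) := fun
    | 0 => ⊤
    | k + 1 => (N (k + 1)).prod ⊥
  let Ψ : MonoidAlgebra ℤ F →ₐ[ℤ] Module.End ℤ (M × ℤ) :=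
    MonoidAlgebra.lift ℤ _ F (crossedAction ρ δ hδ)
  have hΨ : ∀ u m k, Ψ (MonoidAlgebra.of ℤ F u) (m, k) = (ρ u m + k • δ u, k) := fun u m k => by
    rw [MonoidAlgebra.lift_of, crossedAction_apply]
  have hanti : ∀ k, S (k + 1) ≤ S k := by
    rintro (_ | k)
    · exact le_top
    · refine Submodule.prod_mono ?_ le_rfl
      rintro m ⟨r, hr, rfl⟩
      exact ⟨r, Subgroup.lowerCentralSeries_antitone _ (Nat.le_succ k) hr, rfl⟩
  have hS : ∀ k u, ∀ m ∈ S k, Ψ (MonoidAlgebra.of ℤ F u) m - m ∈ S (k + 1) := by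
    rintro (_ | k) u ⟨m, j⟩ hm
    · rw [hΨ]
      obtain ⟨r, hr⟩ := ι_surj (ρ u m + j • δ u - m)
      exact ⟨mem_N.2 ⟨r, Subgroup.mem_top _, hr⟩, sub_self j⟩
    · obtain ⟨⟨r, hr, rfl⟩, hj⟩ := hm
      obtain rfl : j = 0 := hj
      change Ψ _ (ι r, 0) - (ι r, 0) ∈ _
      rw [hΨ, zero_smul, add_zero]
      refine ⟨mem_N.2 ⟨MulAut.conjNormal (a u) r * r⁻¹, ?_,
        (ι_mul _ _).trans (sub_eq_add_neg (ρ u (ι r)) (ι r)).symm⟩, sub_self 0⟩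
      have h := Subgroup.commutator_mem_commutator (Subgroup.mem_top (a u)) hr
      rw [Subgroup.commutator_comm] at h
      exact h
  -- v - 1 sends (0, 1) to (δ v, 0), and r - 1 kills this since a r ∈ R' acts trivially on the
  -- abelianization of R'.
  have hrel : ∀ z ∈ relAug π, Ψ z (0, 1) = 0 := by
    intro z hz
    induction hz using AddSubgroup.closure_induction with
    | mem z hz =>
      obtain ⟨r, hr, v, rfl⟩ := hz
      have h : ρ r (δ v) = δ v := by
        change ι (⟨a r, ha r hr⟩ * _ * ⟨a r, ha r hr⟩⁻¹) = ι _
        rw [ι_mul, ι_mul, add_right_comm, ← ι_mul, mul_inv_cancel]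
        exact zero_add _
      have h' : Ψ (MonoidAlgebra.of ℤ F v - 1) (0, 1) = (δ v, 0) := by
        rw [map_sub, LinearMap.sub_apply, hΨ]
        simp
      rw [map_mul, Module.End.mul_apply, h', map_sub, LinearMap.sub_apply, hΨ, h]
      simp
    | zero => simp
    | add x y _ _ hx hy => rw [map_add, LinearMap.add_apply, hx, hy, add_zero]
    | neg x _ hx => rw [map_neg, LinearMap.neg_apply, hx, neg_zero]
  obtain ⟨y, hy, z, hz, hyz⟩ := AddSubgroup.mem_sup.1 hx
  have h1 : Ψ z (0, 1) ∈ S (0 + (n + 1)) :=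
    map_mem_of_mem_augIdeal_pow Ψ hanti hS hz Submodule.mem_top
  have h2 : Ψ z (0, 1) = (δ x, 0) := by
    have h3 := congrArg (fun w => Ψ w ((0, 1) : M × ℤ)) hyz
    simp only [map_add, LinearMap.add_apply, hrel y hy, zero_add] at h3
    rw [h3, map_sub, LinearMap.sub_apply, hΨ]
    simp
  rw [h2, Nat.zero_add] at h1
  obtain ⟨⟨r, hr, hrx⟩, -⟩ := h1
  -- δ x is the class of some r ∈ R' ∩ γ_{n+1}(F'), so the two representatives differ by a
  -- commutator.
  have h3 : (⟨a x * (b x)⁻¹, hab x⟩ * r⁻¹ : R') ∈ commutator R' := by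
    rw [← Abelianization.ker_of, MonoidHom.mem_ker, map_mul, map_inv, mul_inv_eq_one]
    exact hrx.symm
  have h4 : a x * (b x)⁻¹ * (r : F')⁻¹ ∈ ⁅R', R'⁆ := by
    rw [← Subgroup.map_subtype_commutator]
    exact ⟨_, h3, rfl⟩
  exact inv_mul_cancel_right (a x * (b x)⁻¹) (r : F') ▸ Subgroup.mul_mem_sup h4 hr

/-- The comparison of lifts for the identity and the trivial homomorphism, with R' = F and exponent
2. -/
theorem mem_gamma_of_mem_relAug_sup (π : F →* G) {n : ℕ} {x : F}
    (hx : MonoidAlgebra.of ℤ F x - 1 ∈ relAug π ⊔ (augIdeal F ^ (n + 2)).toAddSubgroup) :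
    x ∈ gamma 2 F := by
  have hle : augIdeal F ^ (n + 2) ≤ augIdeal F ^ 2 :=
    (Ideal.IsTwoSided.pow_add (I := augIdeal F) n 2).le.trans Ideal.mul_le_right
  have h := mul_inv_mem_of_mem_relAug_sup π (MonoidHom.id F) (1 : F →* F) ⊤
    (fun _ => Subgroup.mem_top _) (fun _ _ => Subgroup.mem_top _) (n := 1)
    ((sup_le_sup_left (show (augIdeal F ^ (n + 2)).toAddSubgroup ≤
      (augIdeal F ^ 2).toAddSubgroup from hle) _) hx)
  have h2 : ⁅(⊤ : Subgroup F), ⊤⁆ ⊔ gamma (1 + 1) F = gamma 2 F := sup_idem _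
  rw [h2] at h
  simpa using h

/-- If the two coproduct inclusions of the free group on `G` agree on `x` modulo
`[R, R] γ`, then the image of `x` in `G` lies in the dimension subgroup. -/
theorem lift_mem_dimSubgroup {n : ℕ} {x : FreeGroup G}
    (hx : (FreeGroup.lift (fun g => FreeGroup.of (Sum.inl g)) x)⁻¹ *
      FreeGroup.lift (fun g => FreeGroup.of (Sum.inr g)) x ∈
      ⁅(FreeGroup.lift (Sum.elim (fun g => g) fun g => g : G ⊕ G → G)).ker,
        (FreeGroup.lift (Sum.elim (fun g => g) fun g => g : G ⊕ G → G)).ker⁆ ⊔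
          gamma (n + 1) (FreeGroup (G ⊕ G))) :
    FreeGroup.lift (fun g : G => g) x ∈ dimSubgroup (n + 1) G := by
  let i₁ : FreeGroup G →* FreeGroup (G ⊕ G) := FreeGroup.lift fun g => FreeGroup.of (Sum.inl g)
  let i₂ : FreeGroup G →* FreeGroup (G ⊕ G) := FreeGroup.lift fun g => FreeGroup.of (Sum.inr g)
  let p : FreeGroup G →* G := FreeGroup.lift fun g => g
  let A := MonoidAlgebra ℤ G
  let π : FreeGroup (G ⊕ G) →* G := FreeGroup.lift (Sum.elim (fun g => g) fun g => g)
  let ρ : G →* Module.End ℤ A :=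
    { toFun g := LinearMap.mulLeft ℤ (MonoidAlgebra.of ℤ G g)
      map_one' := by rw [map_one]; exact LinearMap.mulLeft_one ℤ A
      map_mul' g h := by rw [map_mul]; exact LinearMap.mulLeft_mul ℤ A _ _ }
  have hρ : ∀ g m, ρ g m = MonoidAlgebra.of ℤ G g * m := fun _ _ => rfl
  let D : G →* Module.End ℤ (A × ℤ) := crossedAction ρ (fun g => MonoidAlgebra.of ℤ G g - 1)
    fun g h => by rw [hρ, map_mul]; noncomm_ring
  let D₀ : G →* Module.End ℤ (A × ℤ) := crossedAction ρ (fun _ => 0) fun g h => by simp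
  -- Both D and D₀ are actions of G itself, so L ∘ i₁ and L ∘ i₂ see only the image of a word in G.
  let L : FreeGroup (G ⊕ G) →* (Module.End ℤ (A × ℤ))ˣ :=
    FreeGroup.lift (Sum.elim D.toHomUnits D₀.toHomUnits)
  have hinl : ∀ y, L (i₁ y) = D.toHomUnits (p y) := by
    have : L.comp i₁ = D.toHomUnits.comp (p) :=
      FreeGroup.ext_hom _ _ fun g => by simp [L, i₁, p]
    exact DFunLike.congr_fun this
  have hinr : ∀ y, L (i₂ y) = D₀.toHomUnits (p y) := by
    have : L.comp i₂ = D₀.toHomUnits.comp (p) :=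
      FreeGroup.ext_hom _ _ fun g => by simp [L, i₂, p]
    exact DFunLike.congr_fun this
  have hL : ∀ y, ∃ d ∈ augIdeal G, ∀ (m : A) (k : ℤ), (L y : Module.End ℤ (A × ℤ)) (m, k) =
      (MonoidAlgebra.of ℤ G (π y) * m + k • d, k) := by
    intro y
    induction y using FreeGroup.induction_on with
    | C1 => exact ⟨0, zero_mem _, fun m k => by simp [← MonoidAlgebra.one_def]⟩
    | of y =>
      rcases y with g | g
      · refine ⟨_, of_sub_one_mem_augIdeal g, fun m k => ?_⟩
        simp only [L, π, FreeGroup.lift_apply_of]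
        rfl
      · refine ⟨0, zero_mem _, fun m k => ?_⟩
        simp only [L, π, FreeGroup.lift_apply_of]
        rfl
    | inv_of y _ =>
      rcases y with g | g
      · refine ⟨_, of_sub_one_mem_augIdeal g⁻¹, fun m k => ?_⟩
        simp only [L, π, FreeGroup.lift_apply_of, map_inv]
        rfl
      · refine ⟨0, zero_mem _, fun m k => ?_⟩
        simp only [L, π, FreeGroup.lift_apply_of, map_inv]
        rfl
    | mul y z hy hz =>
      obtain ⟨d, hd, hy⟩ := hy
      obtain ⟨e, he, hz⟩ := hz
      refine ⟨MonoidAlgebra.of ℤ G (π y) * e + d, add_mem (Ideal.mul_mem_left _ _ he) hd,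
        fun m k => ?_⟩
      rw [map_mul, Units.val_mul, Module.End.mul_apply, hz, hy, map_mul, map_mul]
      simp only [mul_add, mul_assoc, smul_add, mul_smul_comm, add_assoc]
  let S : ℕ → Submodule ℤ (A × ℤ) := fun
    | 0 => ⊤
    | k + 1 => ((augIdeal G ^ (k + 1)).restrictScalars ℤ).prod ⊥
  let Ψ : MonoidAlgebra ℤ (FreeGroup (G ⊕ G)) →ₐ[ℤ] Module.End ℤ (A × ℤ) :=
    MonoidAlgebra.lift ℤ _ _ ((Units.coeHom _).comp L)
  have hΨ : ∀ y, Ψ (MonoidAlgebra.of ℤ _ y) = L y := fun y => MonoidAlgebra.lift_of _ _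
  have hanti : ∀ k, S (k + 1) ≤ S k := by
    rintro (_ | k)
    · exact le_top
    · refine Submodule.prod_mono ?_ le_rfl
      have h : augIdeal G ^ (k + 1 + 1) ≤ augIdeal G ^ (k + 1) := by
        rw [Submodule.pow_succ' _ (Nat.succ_ne_zero k)]
        exact Ideal.mul_le.2 fun r _ s hs => Ideal.mul_mem_left _ r hs
      exact h
  have hS : ∀ k y, ∀ m ∈ S k, Ψ (MonoidAlgebra.of ℤ _ y) m - m ∈ S (k + 1) := by
    rintro k y ⟨m, j⟩ hm
    obtain ⟨d, hd, hy⟩ := hL y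
    have h1 : MonoidAlgebra.of ℤ G (π y) * m + j • d - m =
      (MonoidAlgebra.of ℤ G (π y) - 1) * m + j • d := by rw [sub_mul, one_mul]; abel
    rw [hΨ, hy]
    refine ⟨?_, sub_self j⟩
    change MonoidAlgebra.of ℤ G (π y) * m + j • d - m ∈ augIdeal G ^ (k + 1)
    rw [h1]
    rcases k with _ | k
    · rw [Nat.zero_add, Submodule.pow_one]
      exact add_mem (Ideal.mul_mem_right _ _ (of_sub_one_mem_augIdeal _)) (zsmul_mem hd j)
    · obtain ⟨hm, hj⟩ := hm
      obtain rfl : j = 0 := hj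
      rw [zero_smul, add_zero, Submodule.pow_succ' _ (Nat.succ_ne_zero k)]
      exact Ideal.mul_mem_mul (of_sub_one_mem_augIdeal _) hm
  -- Elements of the kernel act by translations (m, k) ↦ (m + kd, k), which commute.
  have hker : ∀ y ∈ ⁅π.ker, π.ker⁆, L y = 1 := by
    suffices h : ⁅π.ker, π.ker⁆ ≤ L.ker from h
    refine Subgroup.commutator_le.2 fun y hy z hz => ?_
    rw [MonoidHom.mem_ker, map_commutatorElement, commutatorElement_eq_one_iff_mul_comm]
    obtain ⟨d, -, hd⟩ := hL y
    obtain ⟨e, -, he⟩ := hL z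
    rw [MonoidHom.mem_ker] at hy hz
    refine Units.ext (LinearMap.ext fun p => ?_)
    obtain ⟨m, k⟩ := p
    rw [Units.val_mul, Units.val_mul, Module.End.mul_apply, Module.End.mul_apply, he, hd, hd, he,
      hy, hz, map_one, one_mul, one_mul, one_mul, add_right_comm]
  obtain ⟨c, hc, d, hd, hcd⟩ := Subgroup.mem_sup_of_normal_left.1 hx
  have h1 : i₂ x = i₁ x * (c * d) := by
    rw [hcd, mul_inv_cancel_left]
  have h2 : Ψ (MonoidAlgebra.of ℤ _ d - 1) (0, 1) ∈ S (0 + (n + 1)) :=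
    map_mem_of_mem_augIdeal_pow (k := n + 1) (j := 0) Ψ hanti hS
      (gamma_succ_le_dimSubgroup n hd) Submodule.mem_top
  -- Apply i₁(x)(d - 1) to (0, 1). Since c acts trivially, i₁(x)d acts as i₂(x) and fixes (0, 1),
  -- while i₁(x) sends it to (p x - 1, 1). The difference is (-(p x - 1), 0).
  have h3 := add_mem (hanti (0 + (n + 1)) (hS (0 + (n + 1)) (i₁ x) _ h2)) h2
  have h4 := congrArg (fun y => (L y : Module.End ℤ (A × ℤ)) (0, 1)) h1
  simp only [map_mul, hker c hc, one_mul, hinr, hinl, Units.val_mul, Module.End.mul_apply] at h4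
  rw [sub_add_cancel, map_sub, map_one, LinearMap.sub_apply, map_sub, hΨ, hΨ, hinl, ← h4,
    Nat.zero_add] at h3
  have h5 := neg_mem h3.1
  change MonoidAlgebra.of ℤ G (p x) - 1 ∈ augIdeal G ^ (n + 1)
  convert h5 using 1
  simp [D, D₀, crossedAction_apply]

end Lifts


/-! ### Exactness at a single presentation. -/

section Subquotients

variable {F F' : Type u} [Group F] [Group F']

theorem subquotMk_eq_iff {H N : Subgroup F} {h : ⁅H, H⁆ ≤ N} {x y : H} :
    subquotMk H N h x = subquotMk H N h y ↔ (x : F)⁻¹ * y ∈ N :=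
  (QuotientGroup.eq (s := N.subgroupOf H) (a := x) (b := y)).trans Subgroup.mem_subgroupOf

theorem subquotMap_injective {H N : Subgroup F} (h : ⁅H, H⁆ ≤ N) {H' N' : Subgroup F'}
    (h' : ⁅H', H'⁆ ≤ N') (f : F →* F') (hH : H ≤ H'.comap f) (hN : N ≤ N'.comap f)
    (hf : ∀ x ∈ H, f x ∈ N' → x ∈ N) : Function.Injective (subquotMap h h' f hH hN) := by
  intro a b hab
  obtain ⟨x, rfl⟩ := subquotMk_surjective H N h a
  obtain ⟨y, rfl⟩ := subquotMk_surjective H N h b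
  rw [subquotMap_mk, subquotMap_mk, subquotMk_eq_iff] at hab
  rw [subquotMk_eq_iff]
  refine hf _ (mul_mem (inv_mem x.2) y.2) ?_
  rwa [map_mul, map_inv]

end Subquotients

theorem exists_fac_of_injective {A B C : AddCommGrpCat.{u}} (f : A ⟶ C) (i : B ⟶ C)
    (hi : Function.Injective i) (h : ∀ a, ∃ b, i b = f a) : ∃ g : A ⟶ B, g ≫ i = f := by
  choose g hg using h
  refine ⟨AddCommGrpCat.ofHom (AddMonoidHom.mk' g fun a b => hi ?_), AddCommGrpCat.ext hg⟩
  rw [map_add, hg, hg, hg, map_add]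

theorem dimQuotIncl_injective (G : GrpCat.{u}) : Function.Injective (dimQuotIncl.app G) := by
  have h := subquotMap_injective (commutator_dimSubgroup_four_le G) (commutator_gamma_two_le G)
    (MonoidHom.id G) (dimSubgroup_four_le G) le_rfl fun _ _ h => h
  exact h

instance (G : GrpCat.{u}) : Mono (dimQuotIncl.app G) :=
  (AddCommGrpCat.mono_iff_injective _).2 (dimQuotIncl_injective G)

/-- The modular law: [R,R] ≤ R gives R ∩ [R,R]γ_4(F) = [R,R](R ∩ γ_4(F)). -/
theorem relIncl_injective (P : Presentation.{u}) : Function.Injective (relIncl.app P) := by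
  have key : ∀ x ∈ rel P ⊓ gamma 2 P.P.F, MonoidHom.id P.P.F x ∈ ⁅rel P, rel P⁆ ⊔ gamma 4 P.P.F →
      x ∈ ⁅rel P, rel P⁆ ⊔ (rel P ⊓ gamma 4 P.P.F) := fun x hx h => by
    obtain ⟨c, hc, d, hd, rfl⟩ := Subgroup.mem_sup_of_normal_left.1
      (show x ∈ ⁅rel P, rel P⁆ ⊔ gamma 4 P.P.F from h)
    have hc' : c ∈ rel P := Subgroup.commutator_le_left _ _ hc
    exact Subgroup.mul_mem_sup hc ⟨((rel P).mul_mem_cancel_left hc').1 hx.1, hd⟩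
  have h := subquotMap_injective
    ((Subgroup.commutator_mono inf_le_left inf_le_left).trans le_sup_left)
    ((commutator_gamma_two_le _).trans le_sup_right) (MonoidHom.id P.P.F) inf_le_right
    (sup_le_sup le_rfl inf_le_right) key
  exact h

instance (P : Presentation.{u}) : Mono (relIncl.app P) :=
  (AddCommGrpCat.mono_iff_injective _).2 (relIncl_injective P)

theorem relIncl_comp_freeProj (P : Presentation.{u}) :
    relIncl.app P ≫ freeProj.app P = 0 :=
  subquot_hom_ext fun x => by
    refine (subquotMk_eq_iff (y := 1)).2 ?_
    have hx : P.P.π x = 1 := x.2.1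
    have h : (P.P.π x)⁻¹ * 1 ∈ gamma 4 P.G := by
      rw [hx, inv_one, one_mul]
      exact one_mem _
    exact h

theorem exists_mem_gamma_lift {F G : Type u} [Group F] [Group G] {π : F →* G}
    (hπ : Function.Surjective π) (n : ℕ) {g : G} (hg : g ∈ gamma n G) :
    ∃ y ∈ gamma n F, π y = g := by
  have h : gamma n G ≤ (gamma n F).map π := by
    rw [gamma, gamma, Subgroup.map_lowerCentralSeries, Subgroup.map_top_of_surjective π hπ]
  exact h hg

/-- γ_4(F) maps onto γ_4(G), so a representative whose image lies in γ_4(G) can be moved into R by a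
factor from γ_4(F). -/
theorem exists_relIncl_eq (P : Presentation.{u}) (t : freeQuot.obj P)
    (ht : freeProj.app P t = 0) : ∃ s, relIncl.app P s = t := by
  obtain ⟨x, rfl⟩ := subquotMk_surjective _ _ _ t
  have h1 : ((1 : gamma 2 P.G) : P.G)⁻¹ * P.P.π x ∈ gamma 4 P.G :=
    (subquotMk_eq_iff (h := commutator_gamma_two_le P.G)).1 ht.symm
  rw [Subgroup.coe_one, inv_one, one_mul] at h1
  obtain ⟨y, hy, hyx⟩ := exists_mem_gamma_lift P.P.surj 4 h1
  have hy2 : y ∈ gamma 2 P.P.F := Subgroup.lowerCentralSeries_antitone _ (by decide) hy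
  refine ⟨subquotMk _ _ _ ⟨x * y⁻¹, ?_, (gamma 2 _).mul_mem x.2 ((gamma 2 _).inv_mem hy2)⟩, ?_⟩
  · change P.P.π (x * y⁻¹) = 1
    rw [map_mul, map_inv, hyx, mul_inv_cancel]
  · refine subquotMk_eq_iff.2 ?_
    change (x * y⁻¹)⁻¹ * (x : P.P.F) ∈ _
    rw [mul_inv_rev, inv_inv, inv_mul_cancel_right]
    exact Subgroup.mem_sup_right hy

/-! ### Elements of the limit. -/

section Limits

variable (T : Presentation.{u} ⥤ AddCommGrpCat.{u})

/-- An element of `T` at the standard presentation on which the coproduct inclusions agree comes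
from the limit. -/
theorem exists_freeLimProj_std_eq {G : GrpCat.{u}} (t : T.obj ((fibre G).obj (std G)))
    (ht : T.map ((fibre G).map (stdInl G)) t = T.map ((fibre G).map (stdInr G)) t) :
    ∃ s, freeLimProj T G (std G) s = t := by
  -- The element t is encoded as a morphism from ℤ, the vertex of a cone.
  let k : AddCommGrpCat.of (ULift.{u} ℤ) ⟶ T.obj ((fibre G).obj (std G)) :=
    AddCommGrpCat.ofHom ((zmultiplesHom _ t).comp AddEquiv.ulift.toAddMonoidHom)
  have hk : k ≫ T.map ((fibre G).map (stdInl G)) = k ≫ T.map ((fibre G).map (stdInr G)) := by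
    ext n
    change T.map _ (n.down • t) = T.map _ (n.down • t)
    rw [map_zsmul, map_zsmul, ht]
  let c : Cone (fibre G ⋙ T) :=
    { pt := AddCommGrpCat.of (ULift.{u} ℤ)
      π :=
        { app Q := k ≫ T.map (stdLift (𝟙 G) Q)
          naturality Q Q' a := by
            have := comp_eq_of_lift T k hk (stdLift (𝟙 G) Q')
              (stdLift (𝟙 G) Q ≫ (fibre G).map a) (Category.id_comp (𝟙 G)).symm
            simpa using this } }
  have hc : limit.lift _ c ≫ freeLimProj T G (std G) = k :=
    (limit.lift_π c (std G)).trans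
      ((comp_eq_of_lift T k hk (stdLift (𝟙 G) (std G)) (𝟙 _) rfl).trans (by simp))
  refine ⟨limit.lift _ c ⟨1⟩, ?_⟩
  have := ConcreteCategory.congr_hom hc (ULift.up 1)
  exact this.trans (one_zsmul t)

end Limits

/-! ### Image and kernel of the map from the limit to γ_2(G)/γ_4(G). -/

theorem freeLim_hom_ext {T : Presentation.{u} ⥤ AddCommGrpCat.{u}} {G : GrpCat.{u}}
    {A : AddCommGrpCat.{u}} {a b : A ⟶ (freeLim T).obj G}
    (h : ∀ P, a ≫ freeLimProj T G P = b ≫ freeLimProj T G P) : a = b :=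
  limit.hom_ext h

/-- The map `γ₂(F)/(γ₂(R)γ₄(F)) ⟶ γ₂(G)/γ₄(G)` induced by `F → G`. -/
def freeProjApp (P : Presentation.{u}) : freeQuot.obj P ⟶ gammaQuot.obj P.G :=
  freeProj.app P

theorem freeProjApp_naturality {P Q : Presentation.{u}} (m : P ⟶ Q) :
    freeQuot.map m ≫ freeProjApp Q = freeProjApp P ≫ gammaQuot.map m.φ :=
  freeProj.naturality m

/-- The map `lim γ₂(F)/(γ₂(R)γ₄(F)) ⟶ γ₂(G)/γ₄(G)` induced by the projections `F → G`. -/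
noncomputable def freeLimToGamma : freeLim freeQuot.{u} ⟶ gammaQuot.{u} where
  app G := freeLimProj freeQuot G (std G) ≫ freeProjApp ⟨G, std G⟩
  naturality G H φ := by
    let m : (⟨G, std G⟩ : Presentation) ⟶ ⟨H, std H⟩ := stdLift φ (std H)
    have h1 : (freeLim freeQuot).map φ ≫ freeLimProj freeQuot H (std H) =
        freeLimProj freeQuot G (std G) ≫ freeQuot.map m :=
      freeLimMap_π freeQuot φ (stdLift φ (std H)) rfl
    rw [← Category.assoc, h1, Category.assoc, freeProjApp_naturality m]
    exact (Category.assoc _ _ _).symm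

/-- Independence of the presentation: a morphism over G induces the identity on γ_2(G)/γ_4(G). -/
theorem freeLimToGamma_app {G : GrpCat.{u}} (P : FreePresentation G) :
    freeLimToGamma.app G = freeLimProj freeQuot G P ≫ freeProjApp ⟨G, P⟩ := by
  let m : (⟨G, std G⟩ : Presentation) ⟶ ⟨G, P⟩ := stdLift (𝟙 G) P
  have h1 : freeLimProj freeQuot G (std G) ≫ freeQuot.map m = freeLimProj freeQuot G P :=
    cone_std freeQuot (limit.cone _) _ rfl
  have h2 : gammaQuot.map m.φ = 𝟙 (gammaQuot.obj G) := gammaQuot.map_id G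
  rw [← h1, Category.assoc, freeProjApp_naturality m, h2, Category.comp_id]
  rfl

theorem exists_dimQuotIncl_eq (G : GrpCat.{u}) (s : (freeLim freeQuot).obj G) :
    ∃ d, dimQuotIncl.app G d = freeLimToGamma.app G s := by
  obtain ⟨x, hx⟩ := subquotMk_surjective _ _ _ (freeLimProj freeQuot G (std G) s)
  have h1 := ConcreteCategory.congr_hom (cone_inl_eq_inr freeQuot (limit.cone (fibre G ⋙ freeQuot)))
    s
  have h2 : freeQuot.map ((fibre G).map (stdInl G)) (freeLimProj freeQuot G (std G) s) =
    freeQuot.map ((fibre G).map (stdInr G)) (freeLimProj freeQuot G (std G) s) := h1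
  rw [← hx] at h2
  have h3 := subquotMk_eq_iff.1 h2
  have hmem : (std G).π x ∈ dimSubgroup 4 G :=
    lift_mem_dimSubgroup (n := 3) h3
  refine ⟨subquotMk _ _ _ ⟨_, hmem⟩, ?_⟩
  exact congrArg (freeProj.app ⟨G, std G⟩) hx

theorem exists_freeLim_eq (G : GrpCat.{u}) (d : dimQuotFour.obj G) :
    ∃ s, freeLimToGamma.app G s = dimQuotIncl.app G d := by
  obtain ⟨⟨g, hg⟩, rfl⟩ := subquotMk_surjective _ _ _ d
  obtain ⟨x, rfl, hx⟩ := exists_lift_mem_relAug_sup (std G).surj hg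
  have hx2 : x ∈ gamma 2 (std G).F := mem_gamma_of_mem_relAug_sup (std G).π hx
  have hab : ∀ u, (stdInl G).f u * ((stdInr G).f u)⁻¹ ∈ (stdTwo G).π.ker := fun u => by
    rw [MonoidHom.mem_ker, map_mul, map_inv, (stdInl G).comm, (stdInr G).comm, mul_inv_cancel]
  have h1 := mul_inv_mem_of_mem_relAug_sup (std G).π (stdInl G).f (stdInr G).f
    (stdTwo G).π.ker hab (fun r hr => by
      rw [MonoidHom.mem_ker, (stdInl G).comm]; exact hr) hx
  -- Equality of classes is tested on left quotients; normality converts the right quotient of `h1`.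
  have h2 : ((stdInl G).f x)⁻¹ * (stdInr G).f x ∈
      ⁅(stdTwo G).π.ker, (stdTwo G).π.ker⁆ ⊔ gamma 4 (stdTwo G).F := by
    have h3 := inv_mem h1
    rw [mul_inv_rev, inv_inv] at h3
    exact (inferInstance : (⁅(stdTwo G).π.ker, (stdTwo G).π.ker⁆ ⊔
      gamma 4 (stdTwo G).F).Normal).mem_comm h3
  obtain ⟨s, hs⟩ := exists_freeLimProj_std_eq freeQuot
    (subquotMk _ _ ((commutator_gamma_two_le _).trans le_sup_right) ⟨x, hx2⟩)
    (subquotMk_eq_iff.2 h2)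
  exact ⟨s, congrArg (freeProj.app ⟨G, std G⟩) hs⟩

theorem freeLimHom_relIncl_comp (G : GrpCat.{u}) (P : FreePresentation G) :
    (freeLimHom relIncl).app G ≫ freeLimProj freeQuot G P =
      freeLimProj relQuot G P ≫ relIncl.app ⟨G, P⟩ :=
  limMap_comp_π relIncl G P

instance (G : GrpCat.{u}) : Mono ((freeLimHom relIncl).app G) where
  right_cancellation {Z} a b hab := by
    refine freeLim_hom_ext fun Q => (cancel_mono (relIncl.app ⟨G, Q⟩)).1 ?_
    rw [Category.assoc, Category.assoc, ← freeLimHom_relIncl_comp, ← Category.assoc, hab,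
      Category.assoc]

theorem freeLimHom_relIncl_comp_freeLimToGamma (G : GrpCat.{u}) :
    (freeLimHom relIncl).app G ≫ freeLimToGamma.app G = 0 := by
  rw [freeLimToGamma_app (std G), ← Category.assoc, freeLimHom_relIncl_comp, Category.assoc]
  exact (congrArg _ (relIncl_comp_freeProj _)).trans comp_zero

/-- Left exactness of the limit: the factorizations at the individual presentations are unique
because `relIncl` is injective, hence they form a cone. -/
theorem exists_fac_freeLimHom_relIncl {G : GrpCat.{u}} {A : AddCommGrpCat.{u}}
    (k : A ⟶ (freeLim freeQuot).obj G) (hk : k ≫ freeLimToGamma.app G = 0) :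
    ∃ l, l ≫ (freeLimHom relIncl).app G = k := by
  have h : ∀ P : FreePresentation G, ∃ g : A ⟶ relQuot.obj ⟨G, P⟩,
      g ≫ relIncl.app ⟨G, P⟩ = k ≫ freeLimProj freeQuot G P := fun P =>
    exists_fac_of_injective _ _ (relIncl_injective _) fun a =>
      exists_relIncl_eq _ _ (by
        rw [freeLimToGamma_app P] at hk
        exact ConcreteCategory.congr_hom hk a)
  choose g hg using h
  have hg_map : ∀ {P Q : FreePresentation G} (a : P ⟶ Q),
      g P ≫ relQuot.map (X := ⟨G, P⟩) (Y := ⟨G, Q⟩) ((fibre G).map a) = g Q := by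
    intro P Q a
    let m : (⟨G, P⟩ : Presentation) ⟶ ⟨G, Q⟩ := (fibre G).map a
    have h2 : freeLimProj freeQuot G P ≫ freeQuot.map m = freeLimProj freeQuot G Q :=
      limit.w (fibre G ⋙ freeQuot) a
    refine (cancel_mono (relIncl.app ⟨G, Q⟩)).1 ?_
    change (g P ≫ relQuot.map m) ≫ _ = _
    rw [Category.assoc, relIncl.naturality m, ← Category.assoc, hg, hg, Category.assoc, h2]
  let c : Cone (fibre G ⋙ relQuot) :=
    { pt := A
      π :=
        { app P := g P
          naturality _ _ a := (Category.id_comp _).trans (hg_map a).symm } }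
  let l : A ⟶ (freeLim relQuot).obj G := limit.lift (fibre G ⋙ relQuot) c
  have hl : ∀ P, l ≫ freeLimProj relQuot G P = g P := fun P => limit.lift_π c P
  refine ⟨l, freeLim_hom_ext fun P => ?_⟩
  rw [Category.assoc, freeLimHom_relIncl_comp, ← Category.assoc, hl, hg]

end DimQuot

/-- There is a natural transformation `q : lim γ₂(F)/(γ₂(R)γ₄(F)) ⟶ D₄(G)/γ₄(G)` of functors of
the group `G`, induced by the projections `F ↠ G`, that forms a short exact sequence together
with the map `lim (R ∩ γ₂(F))/(γ₂(R)(R ∩ γ₄(F))) ⟶ lim γ₂(F)/(γ₂(R)γ₄(F))` induced by the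
inclusions `R ∩ γ₂(F) ≤ γ₂(F)`. -/
theorem theorem1 :
    ∃ q : DimQuot.freeLim DimQuot.freeQuot.{u} ⟶ DimQuot.dimQuotFour.{u},
      (∀ (G : GrpCat.{u}) (P : DimQuot.FreePresentation G),
        q.app G ≫ DimQuot.dimQuotIncl.app G =
          DimQuot.freeLimProj DimQuot.freeQuot G P ≫ DimQuot.freeProj.app ⟨G, P⟩) ∧
      ∀ G : GrpCat.{u},
        ∃ w : (DimQuot.freeLimHom DimQuot.relIncl).app G ≫ q.app G = 0,
          (ShortComplex.mk _ _ w).ShortExact := by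
  choose q hq using fun G : GrpCat.{u} => DimQuot.exists_fac_of_injective
    (DimQuot.freeLimToGamma.app G) (DimQuot.dimQuotIncl.app G) (DimQuot.dimQuotIncl_injective G)
    (DimQuot.exists_dimQuotIncl_eq G)
  refine ⟨{ app := q, naturality := fun G H φ => ?_ },
    fun G P => (hq G).trans (DimQuot.freeLimToGamma_app P), fun G => ?_⟩
  -- Naturality is inherited from the map to γ_2/γ_4, into which D_4/γ_4 embeds naturally.
  · rw [← cancel_mono (DimQuot.dimQuotIncl.app H), Category.assoc, Category.assoc,
      DimQuot.dimQuotIncl.naturality, hq, ← Category.assoc (q G), hq]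
    exact DimQuot.freeLimToGamma.naturality φ
  · have w : (DimQuot.freeLimHom DimQuot.relIncl).app G ≫ q G = 0 := by
      rw [← cancel_mono (DimQuot.dimQuotIncl.app G), Category.assoc, hq,
        DimQuot.freeLimHom_relIncl_comp_freeLimToGamma, zero_comp]
    have hepi : Epi (q G) := by
      refine (AddCommGrpCat.epi_iff_surjective _).2 fun d => ?_
      obtain ⟨s, hs⟩ := DimQuot.exists_freeLim_eq G d
      refine ⟨s, DimQuot.dimQuotIncl_injective G ?_⟩
      rw [← hs, ← hq]
      rfl
    have hmono : Mono ((DimQuot.freeLimHom DimQuot.relIncl).app G) := inferInstance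
    refine ⟨w, { exact := ?_, mono_f := hmono, epi_g := hepi }⟩
    refine ShortComplex.exact_of_f_is_kernel _ (KernelFork.IsLimit.ofι' _ w fun k hk => ?_)
    have h := DimQuot.exists_fac_freeLimHom_relIncl k (by
      rw [← hq, ← Category.assoc, hk, zero_comp])
    exact ⟨h.choose, h.choose_spec⟩
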